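/- Let $N\le m$ be positive integers. An $N\times m$ (two-symbol) supersaturated design (SSD) is an $N\times m$ matrix $\mathbf D$ with entries $\pm1$ such that $+1$ and $-1$ occur equally often in each column and no two distinct columns satisfy $\mathbf d_i=\mathbf d_j$ or $\mathbf d_i=-\mathbf d_j$. Let $s_{ij}$ be the $(i,j)$ entry of $\mathbf D^{\top}\mathbf D$, and put $$\mathrm E(s^2)=\binom m2^{-1}\sum_{i<j}s_{ij}^2,\qquad s_{\max}=\max_{i<j}|s_{ij}|,\qquad f_{s_{\max}}=\#\{(i,j): i<j,\ |s_{ij}|=s_{\max}\}.$$ An SSD is $\mathrm E(s^2)$-optimal if no SSD of the same size has a smaller $\mathrm E(s^2)$. It is minimax-optimal if no SSD of the same size has a smaller $s_{\max}$, or the same $s_{\max}$ and a smaller $f_{s_{\max}}$. For even $N$ and $m>N-1$, let $q$ be a nonnegative integer with $-2N+2<m-q(N-1)<2N-2$ and $m+q\equiv2\pmod 4$. Put $g=(m+q)^2N-q^2N^2-mN^2$ and $a=|m-q(N-1)|$. The Ryan–Bulutoglu bound $b(N,m)$ is defined as follows. If $N\equiv0\pmod4$, then $$m(m-1)\,b(N,m)=\begin{cases}g+2N^2-4N,&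 a<N-1,\\ g-2N^2+4N+4Na,& N-1<a\le\frac32N-2,\\ g+4N^2-4N,& a>\frac32N-2.\end{cases}$$ If $N\equiv2\pmod4$, then $$m(m-1)\,b(N,m)=4m(m-1)+64\max\bigl\{0,\lceil m(m-1)(h-4)/64\rceil\bigr\},$$ where, for even $q$, $$m(m-1)\,h=\begin{cases}g+2N^2-4N+8,& a<N-1,\\ g-2N^2+20N+(4N-8)a-24,& N-1<a\le\frac32N-3,\\ g+4N^2-4N,& a>\frac32N-3,\end{cases}$$ and, for odd $q$, $$m(m-1)\,h=\begin{cases}g+2N^2-4N,& a<N-1,\\ g-2N^2+4N+4Na,& N-1<a\le\frac32N-1,\\ g+4N^2-12N+8a+8,& a>\frac32N-1.\end{cases}$$ **Theorem.** For each pair $(N,m)$ in the table, exactly one nonnegative integer $q$ satisfies the two conditions above. The $N\times m$ matrix $\mathbf D$ listed for $(N,m)$ below the table is an SSD with the tabulated values of $s_{\max}$, $f_{s_{\max}}$ and $\mathrm E(s^2)$. It attains the Ryan–Bulutoglu bound, $\mathrm E(s^2)=b(N,m)$, and it is both $\mathrm E(s^2)$-optimal and minimax-optimal. $$\begin{array}{ccccc}N&m&s_{\max}&f_{s_{\max}}&\mathrm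 E(s^2)\\ \hline 16&25&4&144&192/25\\ 16&26&4&160&512/65\\ 16&27&4&184&2944/351\\ 18&23&6&17&1556/253\\ 18&24&6&23&20/3\\ 18&25&6&30&36/5\\ 18&26&6&37&2484/325\\ 18&27&6&45&316/39\\ 18&28&6&53&1604/189\\ 18&29&6&60&1772/203\\ 20&21&4&50&80/21\\ 22&22&2&231&4\\ 22&23&2&253&4\\ 24&24&4&36&48/23\\ 24&25&4&72&96/25 \end{array}$$ The matrices are listed row by row. Each row is a word of $m$ digits, in which the digit $1$ stands for the entry $+1$ and the digit $0$ for the entry $-1$. $(N,m)=(16,25)$: 0100001010110101111000001, 1010001001000100101011010, 0111100010001010110011011, 1010111011110011011111111, 0101011011001011001010100, 1101000101100001100111101, 0100010101010110010001111, 0010001111111010000101000, 1000010100001011101100011, 0111011100111100111110110, 1001100111111100001010011, 1011100001011111110000100, 0000110010100110100110100, 0011110100100001011001000, 1100101110001101010101110, 1111111000010000000100001. $(N,m)=(16,26)$: 10000000010001101100000110, 10110010101110001101110010, 01111101111011000101001110, 11011101010100100101110001, 10101111111000010110000000, 00010010001001000111011001, 01000001111000011011110111, 01111001000101011000010000, 10011110010010011000011111,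 11110011011111111110101101, 01100110110111100010010011, 00011011100100100010101110, 00001100100111011111100101, 11100110100001110001111100, 00100101001010101000101001, 11001000001110110011001010. $(N,m)=(16,27)$: 000101011100100110010010100, 011010010001000110110101110, 110111100111010011010110010, 000010111110101111101100010, 000001100001111001000001110, 010000110101000000001010001, 011111010010101001110000001, 101100010100011101011101000, 101010001001011111000010001, 101011101000000000111011010, 110101011001111010101111011, 110000111010110101110111101, 111101101111001100100100100, 111001000110100111001001111, 000110001010010000001100111, 001110100111111010111011101. $(N,m)=(18,23)$: 01101001010011110111110, 00001010110101010110001, 10100110010010011010100, 01000010111110101011111, 10111101111100100011101, 00011111000011100000101, 01010001011101011000100, 01110100100111101110000, 11011010100000111101100, 11101111011100111100011, 11101000000110000001001, 11110011101011010010011, 10010000011010100100010, 10011100001111011111111, 00100001100000001100111, 10000101100101110001010, 00111110111001001001010, 01000111001000000111000. $(N,m)=(18,24)$: 101101001100001111000101, 000000011111101100110001, 101001110001000101100010, 011111000110001001111000, 011110010100110101010111, 010000110111011111001100, 111010101101100110111100, 100110111010100011010000, 000011101111010011110111, 101010000011101001001111, 111001010010111010110110, 110111100001011100010001, 100000000100010000011010,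 010011011010000110001011, 010100101000001000100110, 110101011001110001101101, 001100100010110110101001, 001111111101111010001010. $(N,m)=(18,25)$: 1101100011101100100001000, 1011011000001010000011101, 1001010101001111111111011, 1011001111110100110000111, 1000100100010110000111110, 1110010111011001010101100, 0001110110111010111010100, 0110010101100010001000010, 0101111011010010101101111, 0010111011000100011110000, 0101001001110011010110000, 0000001010101111011001110, 0111100110000001010011011, 0110001100111100101111001, 1101111100100101001100101, 0010100001101001100110111, 1110111000011111110000010, 1000000010010001101000001. $(N,m)=(18,26)$: 11001000000110111110100000, 00111111000110110110011001, 01011100111100001100111011, 11101101010001000100110101, 11010011011111110101111110, 01011101101000110011100100, 10100110111010100000110000, 01000011100000000111010010, 10010000101011000110001101, 01101011101111101000000111, 10111011011010001011100011, 00100001110101010010101010, 00111000110011111101010110, 10010100000101100001000011, 11110010100100011001111101, 01100110011001111111001001, 00000101010110001001001100, 10001110001001011010011110. $(N,m)=(18,27)$: 100010111001110110111010010, 111010100111001101000110010, 010101100001111111100110101, 001111000101101101111001011, 011000000011100010001011000, 001011110010110001011100001, 100001010101000001010010100, 101001011011011011101101110, 100010001010101000100000101, 110001100100010100001001111, 100100101110111011010011011,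 010111011010010101100011000, 110110110100100011101101100, 011111101000001010010000110, 011000111101011000110101001, 000110010011000110010101111, 001100011100111100001110110, 111101001110000110111110001. $(N,m)=(18,28)$: 0101001101001110110001011111, 1110110000110110111100001111, 0001101100111011011100010010, 1001010000001001100101000101, 1010101011001001111001101010, 1101111010111100110011110001, 0100000110111001101010101111, 0011001010000100011010000100, 0100110001010001011011011100, 1010011100011110001111111100, 1110010111101101010110010010, 0011110101101010010010101001, 0010100110010111100001010001, 0110001000100000100100111000, 1111011011010011000000110111, 0000111111100100001101100111, 1001000011110010000111001010, 1101100101000111101110100000. $(N,m)=(18,29)$: 10110110000001110000011110001, 01010000111000011000000010000, 00001010010110100101010100000, 10011010010100010011101011111, 01111111010010011100101101010, 10000101111110110110111010010, 11101011111111111000011001101, 11000010001010001110110111101, 01010101110011100001110111111, 10001001100011011011000100011, 11110001000101111111110001000, 00101100011101101010100111011, 00100011100000100010000001110, 11100001011101000101001110110, 11111100100110000100100000101, 00111101001010001011011010100, 01001110101001110111101100100, 00010110101101001101011001011. $(N,m)=(20,21)$: 101001110101101000111, 000110010111001010000, 101111101011011110101, 001010111110000101001, 010000111011101111110, 111001000110100110100,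 000111100001100101100, 111110010000001101111, 111100110011110011001, 001001000010011001010, 100111011110110011110, 110101101100001011000, 110011001011000000011, 011101111101010100010, 011010001101111001100, 010011110000010010101, 001100001000100010011, 010110100110111100011, 100000011000111100000, 100000000101010111111. $(N,m)=(22,22)$: 0110100011001011011011, 0100000110110110010011, 1100001001011000100010, 0010110001111100100111, 1010001110000001000111, 1010010101000010110100, 1111010100111011100011, 0001100100011001010100, 1100011101101101011001, 0000111010101010000000, 0001010111000000101001, 1101111000000100010111, 0111000000100100001100, 1110101110011110101101, 0001001011101111110101, 1011100110101100111010, 0101101101100011101110, 1100110010110001111100, 1001010011011111001110, 1011101001110010011001, 0010011000010111111010, 0111111111010101000000. $(N,m)=(22,23)$: 01110101101101101101011, 11110011011001001000100, 01101011001010110100111, 00000000001110001101100, 00100111111010110011000, 01011110111110011000001, 11000011010100111111001, 11110000010110110001010, 00111100001001010110000, 10001010101001111001010, 01000101100000011010110, 01011110010011101111110, 00110000110101110110100, 10101100011100101010111, 10101101110011011101101, 00011001010000000001011, 01101010100101000011101, 10010111001111010011111, 11001001111111000110010, 10011111100100100100100, 11000100000011100000001, 10110010100010001110011. $(N,m)=(24,24)$: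 011110110101011101101111, 110100111000010010000101, 000010111110000101010100, 011100000111100000100100, 111001010001001101000000, 100100001011010101111001, 011001111010110001101010, 111001101101100100011111, 101111100010011000011100, 111010011110001010111001, 001100101000001110110010, 011011000000110111110101, 000010000000000000001011, 010000100101111011011000, 001111011101110110001000, 100101010100000011111110, 001001001111011011000111, 000001110011101110101101, 110011100111010110100010, 010101010110111100010011, 100111101100101001100001, 101110110011100011010011, 100010011001111000110110, 110110001010101111001110. $(N,m)=(24,25)$: 0010110011011010000100001, 0000111111110101111110011, 0111101000011111011101111, 1110110101000010011011111, 0010011101001111110000100, 1010001011100001100101111, 1001010010111011111011101, 1101011110010110000000111, 1100110000110100110101100, 0100111010001000101001010, 1011100010100110111000010, 0111001110010010110111000, 0111010100100001001100001, 1111011001111001010010010, 0010000100111100100011011, 0001010001000111000111010, 0110000011010101001010100, 1000001000001100011110001, 1011111111101100001111100, 1001000101011000101100110, 0100100110101011010110110, 1000101100110011001001000, 1101100111001101110001001, 0101101001100010100010101. -/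

import Mathlib

/-- The Gram matrix `DᵀD`, whose `(i, j)` entry is `s_ij`. -/
def gram {N m : ℕ} (D : Matrix (Fin N) (Fin m) ℤ) : Matrix (Fin m) (Fin m) ℤ :=
  D.transpose * D

/-- The pairs of column indices `i < j`. -/
def columnPairs (m : ℕ) : Finset (Fin m × Fin m) :=
  Finset.univ.filter fun p => p.1 < p.2

/-- Two-symbol supersaturated design with `N` rows and `m` columns: `N ≤ m`, all entries are `±1`,
every column contains `1` and `-1` equally often, and no two columns agree up to sign. -/
structure IsSSD {N m : ℕ} (D : Matrix (Fin N) (Fin m) ℤ) : Prop where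
  rows_le_cols : N ≤ m
  entries : ∀ i j, D i j = 1 ∨ D i j = -1
  balanced : ∀ j, (Finset.univ.filter fun i => D i j = 1).card =
    (Finset.univ.filter fun i => D i j = -1).card
  col_ne : ∀ j k, j ≠ k → D.col j ≠ D.col k
  col_ne_neg : ∀ j k, j ≠ k → D.col j ≠ -D.col k

/-- `E(s²)`, the average of `s_ij²` over `i < j`. -/
def Es2 {N m : ℕ} (D : Matrix (Fin N) (Fin m) ℤ) : ℚ :=
  ∑ p ∈ columnPairs m, (gram D p.1 p.2 : ℚ) ^ 2 / (m.choose 2 : ℚ)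

/-- `s_max`, the maximum of `|s_ij|` over `i < j`. -/
def sMax {N m : ℕ} (D : Matrix (Fin N) (Fin m) ℤ) : ℕ :=
  (columnPairs m).sup fun p => (gram D p.1 p.2).natAbs

/-- The number of pairs `i < j` with `|s_ij| = s_max`. -/
def freqSMax {N m : ℕ} (D : Matrix (Fin N) (Fin m) ℤ) : ℕ :=
  ((columnPairs m).filter fun p => (gram D p.1 p.2).natAbs = sMax D).card

/-- No SSD of the same size has a smaller `E(s²)`. -/
def IsEs2Optimal {N m : ℕ} (D : Matrix (Fin N) (Fin m) ℤ) : Prop :=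
  IsSSD D ∧ ∀ D' : Matrix (Fin N) (Fin m) ℤ, IsSSD D' → ¬ Es2 D' < Es2 D

/-- No SSD of the same size has a smaller `s_max`, or the same `s_max` with a smaller frequency. -/
def IsMinimaxOptimal {N m : ℕ} (D : Matrix (Fin N) (Fin m) ℤ) : Prop :=
  IsSSD D ∧ ∀ D' : Matrix (Fin N) (Fin m) ℤ, IsSSD D' →
    ¬ (sMax D' < sMax D ∨ (sMax D' = sMax D ∧ freqSMax D' < freqSMax D))

/-- The condition that singles out the integer `q` in the Ryan–Bulutoglu bound. -/
def IsRBIndex (N m q : ℕ) : Prop :=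
  -2 * (N : ℤ) + 2 < (m : ℤ) - q * ((N : ℤ) - 1) ∧
    (m : ℤ) - q * ((N : ℤ) - 1) < 2 * (N : ℤ) - 2 ∧ (m + q) % 4 = 2

/-- `g = (m + q)² N - q² N² - m N²`. -/
def rbG (N m q : ℕ) : ℚ :=
  ((m : ℚ) + q) ^ 2 * N - (q : ℚ) ^ 2 * (N : ℚ) ^ 2 - (m : ℚ) * (N : ℚ) ^ 2

/-- `|m - q (N - 1)|`. For even `N` and `m + q ≡ 2 (mod 4)` it differs from `N - 1`, by parity, so
that the three ranges distinguished below are exhaustive. -/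
def rbDist (N m q : ℕ) : ℚ :=
  |(m : ℚ) - q * ((N : ℚ) - 1)|

/-- The Ryan–Bulutoglu bound for `N ≡ 0 (mod 4)`. -/
def rbBoundZero (N m q : ℕ) : ℚ :=
  if rbDist N m q < N - 1 then
    (rbG N m q + 2 * N ^ 2 - 4 * N) / (m * (m - 1))
  else if rbDist N m q ≤ 3 / 2 * N - 2 then
    (rbG N m q - 2 * N ^ 2 + 4 * N + 4 * N * rbDist N m q) / (m * (m - 1))
  else
    (rbG N m q + 4 * N ^ 2 - 4 * N) / (m * (m - 1))

/-- The quantity `h` in the case `N ≡ 2 (mod 4)`, for even and for odd `q`. -/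
def rbH (N m q : ℕ) : ℚ :=
  if q % 2 = 0 then
    if rbDist N m q < N - 1 then
      (rbG N m q + 2 * N ^ 2 - 4 * N + 8) / (m * (m - 1))
    else if rbDist N m q ≤ 3 / 2 * N - 3 then
      (rbG N m q - 2 * N ^ 2 + 20 * N + (4 * N - 8) * rbDist N m q - 24) / (m * (m - 1))
    else
      (rbG N m q + 4 * N ^ 2 - 4 * N) / (m * (m - 1))
  else
    if rbDist N m q < N - 1 then
      (rbG N m q + 2 * N ^ 2 - 4 * N) / (m * (m - 1))
    else if rbDist N m q ≤ 3 / 2 * N - 1 then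
      (rbG N m q - 2 * N ^ 2 + 4 * N + 4 * N * rbDist N m q) / (m * (m - 1))
    else
      (rbG N m q + 4 * N ^ 2 - 12 * N + 8 * rbDist N m q + 8) / (m * (m - 1))

/-- The Ryan–Bulutoglu bound for `N ≡ 2 (mod 4)`. -/
def rbBoundTwo (N m q : ℕ) : ℚ :=
  (4 * m * (m - 1) + 64 * (max 0 ⌈(m : ℚ) * (m - 1) * (rbH N m q - 4) / 64⌉ : ℤ)) / (m * (m - 1))

/-- The Ryan–Bulutoglu lower bound on `E(s²)` for even `N`, as a function of `N`, `m` and `q`. -/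
def rbBound (N m q : ℕ) : ℚ :=
  if N % 4 = 0 then rbBoundZero N m q else rbBoundTwo N m q

/-- `E(s²)` equals the Ryan–Bulutoglu lower bound; the index `q` of the bound is unique. -/
def AttainsRBBound {N m : ℕ} (D : Matrix (Fin N) (Fin m) ℤ) : Prop :=
  ∃ q : ℕ, (∀ q' : ℕ, IsRBIndex N m q' ↔ q' = q) ∧ Es2 D = rbBound N m q

/-- `D` is an SSD with `s_max = s`, frequency `f` of `s_max`, and `E(s²) = e`; it attains the
Ryan–Bulutoglu bound, and it is both `E(s²)`-optimal and minimax-optimal. -/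
structure IsOptimalDesign {N m : ℕ} (D : Matrix (Fin N) (Fin m) ℤ) (s f : ℕ) (e : ℚ) : Prop where
  isSSD : IsSSD D
  sMax_eq : sMax D = s
  freqSMax_eq : freqSMax D = f
  es2_eq : Es2 D = e
  attains : AttainsRBBound D
  es2Optimal : IsEs2Optimal D
  minimaxOptimal : IsMinimaxOptimal D

/-- The `±1` matrix whose `i`-th row is spelled by the `m` binary digits of the `i`-th number in
`rows`, read from left to right: the digit `1` stands for the entry `1`, `0` for the entry `-1`. -/
def signMatrix (N m : ℕ) (rows : List ℕ) : Matrix (Fin N) (Fin m) ℤ :=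
  Matrix.of fun i j => if (rows.getD i 0).testBit (j.rev : ℕ) then 1 else -1

/-- The design with 16 rows and 25 columns. -/
def design_16_25 : Matrix (Fin 16) (Fin 25) ℤ :=
  signMatrix 16 25 [
    0b0100001010110101111000001, 0b1010001001000100101011010, 0b0111100010001010110011011,
    0b1010111011110011011111111, 0b0101011011001011001010100, 0b1101000101100001100111101,
    0b0100010101010110010001111, 0b0010001111111010000101000, 0b1000010100001011101100011,
    0b0111011100111100111110110, 0b1001100111111100001010011, 0b1011100001011111110000100,
    0b0000110010100110100110100, 0b0011110100100001011001000, 0b1100101110001101010101110,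
    0b1111111000010000000100001]

/-- The design with 16 rows and 26 columns. -/
def design_16_26 : Matrix (Fin 16) (Fin 26) ℤ :=
  signMatrix 16 26 [
    0b10000000010001101100000110, 0b10110010101110001101110010, 0b01111101111011000101001110,
    0b11011101010100100101110001, 0b10101111111000010110000000, 0b00010010001001000111011001,
    0b01000001111000011011110111, 0b01111001000101011000010000, 0b10011110010010011000011111,
    0b11110011011111111110101101, 0b01100110110111100010010011, 0b00011011100100100010101110,
    0b00001100100111011111100101, 0b11100110100001110001111100, 0b00100101001010101000101001,
    0b11001000001110110011001010]

/-- The design with 16 rows and 27 columns. -/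
def design_16_27 : Matrix (Fin 16) (Fin 27) ℤ :=
  signMatrix 16 27 [
    0b000101011100100110010010100, 0b011010010001000110110101110, 0b110111100111010011010110010,
    0b000010111110101111101100010, 0b000001100001111001000001110, 0b010000110101000000001010001,
    0b011111010010101001110000001, 0b101100010100011101011101000, 0b101010001001011111000010001,
    0b101011101000000000111011010, 0b110101011001111010101111011, 0b110000111010110101110111101,
    0b111101101111001100100100100, 0b111001000110100111001001111, 0b000110001010010000001100111,
    0b001110100111111010111011101]

/-- The design with 18 rows and 23 columns. -/
def design_18_23 : Matrix (Fin 18) (Fin 23) ℤ :=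
  signMatrix 18 23 [
    0b01101001010011110111110, 0b00001010110101010110001, 0b10100110010010011010100,
    0b01000010111110101011111, 0b10111101111100100011101, 0b00011111000011100000101,
    0b01010001011101011000100, 0b01110100100111101110000, 0b11011010100000111101100,
    0b11101111011100111100011, 0b11101000000110000001001, 0b11110011101011010010011,
    0b10010000011010100100010, 0b10011100001111011111111, 0b00100001100000001100111,
    0b10000101100101110001010, 0b00111110111001001001010, 0b01000111001000000111000]

/-- The design with 18 rows and 24 columns. -/
def design_18_24 : Matrix (Fin 18) (Fin 24) ℤ :=
  signMatrix 18 24 [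
    0b101101001100001111000101, 0b000000011111101100110001, 0b101001110001000101100010,
    0b011111000110001001111000, 0b011110010100110101010111, 0b010000110111011111001100,
    0b111010101101100110111100, 0b100110111010100011010000, 0b000011101111010011110111,
    0b101010000011101001001111, 0b111001010010111010110110, 0b110111100001011100010001,
    0b100000000100010000011010, 0b010011011010000110001011, 0b010100101000001000100110,
    0b110101011001110001101101, 0b001100100010110110101001, 0b001111111101111010001010]

/-- The design with 18 rows and 25 columns. -/
def design_18_25 : Matrix (Fin 18) (Fin 25) ℤ :=
  signMatrix 18 25 [
    0b1101100011101100100001000, 0b1011011000001010000011101, 0b1001010101001111111111011,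
    0b1011001111110100110000111, 0b1000100100010110000111110, 0b1110010111011001010101100,
    0b0001110110111010111010100, 0b0110010101100010001000010, 0b0101111011010010101101111,
    0b0010111011000100011110000, 0b0101001001110011010110000, 0b0000001010101111011001110,
    0b0111100110000001010011011, 0b0110001100111100101111001, 0b1101111100100101001100101,
    0b0010100001101001100110111, 0b1110111000011111110000010, 0b1000000010010001101000001]

/-- The design with 18 rows and 26 columns. -/
def design_18_26 : Matrix (Fin 18) (Fin 26) ℤ :=
  signMatrix 18 26 [
    0b11001000000110111110100000, 0b00111111000110110110011001, 0b01011100111100001100111011,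
    0b11101101010001000100110101, 0b11010011011111110101111110, 0b01011101101000110011100100,
    0b10100110111010100000110000, 0b01000011100000000111010010, 0b10010000101011000110001101,
    0b01101011101111101000000111, 0b10111011011010001011100011, 0b00100001110101010010101010,
    0b00111000110011111101010110, 0b10010100000101100001000011, 0b11110010100100011001111101,
    0b01100110011001111111001001, 0b00000101010110001001001100, 0b10001110001001011010011110]

/-- The design with 18 rows and 27 columns. -/
def design_18_27 : Matrix (Fin 18) (Fin 27) ℤ :=
  signMatrix 18 27 [
    0b100010111001110110111010010, 0b111010100111001101000110010, 0b010101100001111111100110101,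
    0b001111000101101101111001011, 0b011000000011100010001011000, 0b001011110010110001011100001,
    0b100001010101000001010010100, 0b101001011011011011101101110, 0b100010001010101000100000101,
    0b110001100100010100001001111, 0b100100101110111011010011011, 0b010111011010010101100011000,
    0b110110110100100011101101100, 0b011111101000001010010000110, 0b011000111101011000110101001,
    0b000110010011000110010101111, 0b001100011100111100001110110, 0b111101001110000110111110001]

/-- The design with 18 rows and 28 columns. -/
def design_18_28 : Matrix (Fin 18) (Fin 28) ℤ :=
  signMatrix 18 28 [
    0b0101001101001110110001011111, 0b1110110000110110111100001111, 0b0001101100111011011100010010,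
    0b1001010000001001100101000101, 0b1010101011001001111001101010, 0b1101111010111100110011110001,
    0b0100000110111001101010101111, 0b0011001010000100011010000100, 0b0100110001010001011011011100,
    0b1010011100011110001111111100, 0b1110010111101101010110010010, 0b0011110101101010010010101001,
    0b0010100110010111100001010001, 0b0110001000100000100100111000, 0b1111011011010011000000110111,
    0b0000111111100100001101100111, 0b1001000011110010000111001010, 0b1101100101000111101110100000]

/-- The design with 18 rows and 29 columns. -/
def design_18_29 : Matrix (Fin 18) (Fin 29) ℤ :=
  signMatrix 18 29 [
    0b10110110000001110000011110001, 0b01010000111000011000000010000, 0b00001010010110100101010100000,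
    0b10011010010100010011101011111, 0b01111111010010011100101101010, 0b10000101111110110110111010010,
    0b11101011111111111000011001101, 0b11000010001010001110110111101, 0b01010101110011100001110111111,
    0b10001001100011011011000100011, 0b11110001000101111111110001000, 0b00101100011101101010100111011,
    0b00100011100000100010000001110, 0b11100001011101000101001110110, 0b11111100100110000100100000101,
    0b00111101001010001011011010100, 0b01001110101001110111101100100, 0b00010110101101001101011001011]

/-- The design with 20 rows and 21 columns. -/
def design_20_21 : Matrix (Fin 20) (Fin 21) ℤ :=
  signMatrix 20 21 [
    0b101001110101101000111, 0b000110010111001010000, 0b101111101011011110101,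
    0b001010111110000101001, 0b010000111011101111110, 0b111001000110100110100,
    0b000111100001100101100, 0b111110010000001101111, 0b111100110011110011001,
    0b001001000010011001010, 0b100111011110110011110, 0b110101101100001011000,
    0b110011001011000000011, 0b011101111101010100010, 0b011010001101111001100,
    0b010011110000010010101, 0b001100001000100010011, 0b010110100110111100011,
    0b100000011000111100000, 0b100000000101010111111]

/-- The design with 22 rows and 22 columns. -/
def design_22_22 : Matrix (Fin 22) (Fin 22) ℤ :=
  signMatrix 22 22 [
    0b0110100011001011011011, 0b0100000110110110010011, 0b1100001001011000100010,
    0b0010110001111100100111, 0b1010001110000001000111, 0b1010010101000010110100,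
    0b1111010100111011100011, 0b0001100100011001010100, 0b1100011101101101011001,
    0b0000111010101010000000, 0b0001010111000000101001, 0b1101111000000100010111,
    0b0111000000100100001100, 0b1110101110011110101101, 0b0001001011101111110101,
    0b1011100110101100111010, 0b0101101101100011101110, 0b1100110010110001111100,
    0b1001010011011111001110, 0b1011101001110010011001, 0b0010011000010111111010,
    0b0111111111010101000000]

/-- The design with 22 rows and 23 columns. -/
def design_22_23 : Matrix (Fin 22) (Fin 23) ℤ :=
  signMatrix 22 23 [
    0b01110101101101101101011, 0b11110011011001001000100, 0b01101011001010110100111,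
    0b00000000001110001101100, 0b00100111111010110011000, 0b01011110111110011000001,
    0b11000011010100111111001, 0b11110000010110110001010, 0b00111100001001010110000,
    0b10001010101001111001010, 0b01000101100000011010110, 0b01011110010011101111110,
    0b00110000110101110110100, 0b10101100011100101010111, 0b10101101110011011101101,
    0b00011001010000000001011, 0b01101010100101000011101, 0b10010111001111010011111,
    0b11001001111111000110010, 0b10011111100100100100100, 0b11000100000011100000001,
    0b10110010100010001110011]

/-- The design with 24 rows and 24 columns. -/
def design_24_24 : Matrix (Fin 24) (Fin 24) ℤ :=
  signMatrix 24 24 [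
    0b011110110101011101101111, 0b110100111000010010000101, 0b000010111110000101010100,
    0b011100000111100000100100, 0b111001010001001101000000, 0b100100001011010101111001,
    0b011001111010110001101010, 0b111001101101100100011111, 0b101111100010011000011100,
    0b111010011110001010111001, 0b001100101000001110110010, 0b011011000000110111110101,
    0b000010000000000000001011, 0b010000100101111011011000, 0b001111011101110110001000,
    0b100101010100000011111110, 0b001001001111011011000111, 0b000001110011101110101101,
    0b110011100111010110100010, 0b010101010110111100010011, 0b100111101100101001100001,
    0b101110110011100011010011, 0b100010011001111000110110, 0b110110001010101111001110]

/-- The design with 24 rows and 25 columns. -/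
def design_24_25 : Matrix (Fin 24) (Fin 25) ℤ :=
  signMatrix 24 25 [
    0b0010110011011010000100001, 0b0000111111110101111110011, 0b0111101000011111011101111,
    0b1110110101000010011011111, 0b0010011101001111110000100, 0b1010001011100001100101111,
    0b1001010010111011111011101, 0b1101011110010110000000111, 0b1100110000110100110101100,
    0b0100111010001000101001010, 0b1011100010100110111000010, 0b0111001110010010110111000,
    0b0111010100100001001100001, 0b1111011001111001010010010, 0b0010000100111100100011011,
    0b0001010001000111000111010, 0b0110000011010101001010100, 0b1000001000001100011110001,
    0b1011111111101100001111100, 0b1001000101011000101100110, 0b0100100110101011010110110,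
    0b1000101100110011001001000, 0b1101100111001101110001001, 0b0101101001100010100010101]

/-!
The columns of `D` are balanced, so the rows of `DDᵀ` sum to zero, and the squares of the entries of
`DDᵀ` have the same sum as those of `DᵀD`. The matrix `U = DDᵀ + q (J - N I)`, with `J` the all-ones
matrix, still has zero row sums, its diagonal is constant, and its sum of squares differs from that
of `DDᵀ` by a known amount. If `m + q ≡ 2 (mod 4)`, an off-diagonal entry of `U` is `2` modulo `4`
when the two rows have the same parity of the number of entries `-1`, and `0` modulo `4` otherwise.
For `σ ∈ {-1, 0, 1}`, an entry `u` therefore satisfies `(u + 4 σ) ^ 2 ≥ 4` in the first case and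
`u (u + 4 σ) ≥ 0` in the second; in the sum over all entries the terms linear in `u` are removed by
the zero row sums. For `σ = ± 1` what is left is concave in the difference in size between the two
classes of rows, and the end point at which it is smallest accounts for the case distinctions of the
Ryan–Bulutoglu bound. For `N ≡ 2 (mod 4)` the ceiling comes from `s_ij ^ 2 ≡ 4 (mod 32)`.

All the `|s_ij|` of an SSD are congruent modulo `4`. If those of an `E(s²)`-optimal design only take
the values `s_max` and `s_max - 4`, then a design with a smaller `s_max`, or with the same `s_max`
and a smaller frequency, would have a smaller `E(s²)`.
-/

open Finset
open scoped Matrix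

section SumsOverPairs

theorem sum_sq_eq_trace_mul_transpose {ι R : Type*} [Fintype ι] [CommSemiring R]
    (A : Matrix ι ι R) : ∑ i, ∑ j, A i j ^ 2 = (A * Aᵀ).trace := by
  classical simp only [← Matrix.sum_hadamard_eq, Matrix.hadamard_apply, sq]

theorem sum_sq_transpose_mul_self {ι κ R : Type*} [Fintype ι] [Fintype κ] [CommSemiring R]
    (A : Matrix ι κ R) : ∑ i, ∑ j, (Aᵀ * A) i j ^ 2 = ∑ k, ∑ l, (A * Aᵀ) k l ^ 2 := by
  rw [sum_sq_eq_trace_mul_transpose, sum_sq_eq_trace_mul_transpose]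
  simp only [Matrix.transpose_mul, Matrix.transpose_transpose]
  rw [Matrix.mul_assoc, Matrix.trace_mul_comm, Matrix.mul_assoc, Matrix.mul_assoc,
    Matrix.mul_assoc]

theorem sum_sum_eq_sum_diag_add_two_mul_sum_columnPairs {R : Type*} [CommSemiring R] {m : ℕ}
    {f : Fin m → Fin m → R} (hf : ∀ i j, f i j = f j i) :
    ∑ i, ∑ j, f i j = ∑ i, f i i + 2 * ∑ p ∈ columnPairs m, f p.1 p.2 := by
  have split_f (i j) : f i j =
      (if i = j then f i j else 0) + (if i < j then f i j else 0) + if j < i then f j i else 0 := by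
    rcases lt_trichotomy i j with h | rfl | h
    · simp [h, h.ne, h.not_gt]
    · simp
    · simp [h, h.ne', h.not_gt, hf i j]
  have sum_pairs : ∑ p ∈ columnPairs m, f p.1 p.2 = ∑ i, ∑ j, if i < j then f i j else 0 := by
    rw [columnPairs, sum_filter, Fintype.sum_prod_type]
  rw [sum_congr rfl fun i _ => sum_congr rfl fun j _ => split_f i j]
  simp only [sum_add_distrib, sum_ite_eq, mem_univ, if_true]
  rw [sum_comm (f := fun i j => if j < i then f j i else 0), ← sum_pairs]
  ring

theorem two_mul_card_columnPairs (m : ℕ) : 2 * (#(columnPairs m) : ℚ) = m * (m - 1) := by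
  have := sum_sum_eq_sum_diag_add_two_mul_sum_columnPairs (m := m) (f := fun _ _ => (1 : ℚ))
    fun _ _ => rfl
  simp only [sum_const, card_univ, Fintype.card_fin, nsmul_eq_mul, mul_one] at this
  linarith

/-- The sum of `s_ij²` over `i < j`: an integer multiple of `E(s²)`. -/
def pairSum {N m : ℕ} (D : Matrix (Fin N) (Fin m) ℤ) : ℤ :=
  ∑ p ∈ columnPairs m, gram D p.1 p.2 ^ 2

variable {N m : ℕ} {D : Matrix (Fin N) (Fin m) ℤ}

theorem Es2_eq_pairSum_div (D : Matrix (Fin N) (Fin m) ℤ) :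
    Es2 D = 2 * pairSum D / (m * (m - 1)) := by
  rw [Es2, ← sum_div, Nat.cast_choose_two, pairSum, div_div_eq_mul_div]
  push_cast
  ring

theorem mul_Es2_eq (D : Matrix (Fin N) (Fin m) ℤ) : m * (m - 1) * Es2 D = 2 * pairSum D := by
  rw [Es2_eq_pairSum_div]
  refine mul_div_cancel_of_imp' fun h => ?_
  have no_pairs : columnPairs m = ∅ := by simpa [h] using two_mul_card_columnPairs m
  simp [pairSum, no_pairs]

theorem cast_mul_pred_nonneg (m : ℕ) : (0 : ℚ) ≤ m * (m - 1) := by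
  rw [← two_mul_card_columnPairs]
  positivity

theorem pairSum_le_pairSum_of_Es2_le {D' : Matrix (Fin N) (Fin m) ℤ} (h : Es2 D ≤ Es2 D') :
    pairSum D ≤ pairSum D' := by
  have := mul_le_mul_of_nonneg_left h (cast_mul_pred_nonneg m)
  rw [mul_Es2_eq, mul_Es2_eq] at this
  exact_mod_cast le_of_mul_le_mul_left this two_pos

theorem div_le_Es2 {x : ℚ} (hx : x ≤ 2 * pairSum D) : x / (m * (m - 1)) ≤ Es2 D := by
  rw [Es2_eq_pairSum_div]
  exact div_le_div_of_nonneg_right hx (cast_mul_pred_nonneg m)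

end SumsOverPairs

section SignVectors

variable {ι : Type*} [Fintype ι] {x y : ι → ℤ}

theorem sum_mul_self_eq_card (hx : ∀ k, x k = 1 ∨ x k = -1) :
    ∑ k, x k * x k = Fintype.card ι := by
  have sq_one (k) : x k * x k = 1 := by rcases hx k with h | h <;> simp [h]
  simp [sq_one]

theorem two_dvd_sum_sub_card (hx : ∀ k, x k = 1 ∨ x k = -1) : 2 ∣ ∑ k, x k - Fintype.card ι := by
  have sum_sub : ∑ k, x k - Fintype.card ι = ∑ k, (x k - 1) := by simp
  rw [sum_sub]
  refine dvd_sum fun k _ => ?_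
  rcases hx k with h | h <;> simp [h]

theorem four_dvd_sum_mul_sub (hx : ∀ k, x k = 1 ∨ x k = -1) (hy : ∀ k, y k = 1 ∨ y k = -1) :
    4 ∣ ∑ k, x k * y k - (∑ k, x k + ∑ k, y k - Fintype.card ι) := by
  have sum_sub : ∑ k, x k * y k - (∑ k, x k + ∑ k, y k - Fintype.card ι) =
      ∑ k, (x k - 1) * (y k - 1) := by
    simp only [sub_mul, mul_sub, sum_sub_distrib, one_mul, mul_one, sum_const, card_univ,
      nsmul_eq_mul]
    ring
  rw [sum_sub]
  refine dvd_sum fun k _ => ?_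
  rcases hx k with h | h <;> rcases hy k with h' | h' <;> simp [h, h']

theorem sum_eq_zero_iff_card_eq_card (hx : ∀ k, x k = 1 ∨ x k = -1) :
    ∑ k, x k = 0 ↔ #{k | x k = 1} = #{k | x k = -1} := by
  have split_x (k) : x k = (if x k = 1 then 1 else 0) - if x k = -1 then 1 else 0 := by
    rcases hx k with h | h <;> simp [h]
  rw [sum_congr rfl fun k _ => split_x k, sum_sub_distrib, sum_boole, sum_boole, sub_eq_zero]
  norm_cast

end SignVectors

section BalancedDesigns

/-- A sign matrix whose columns sum to zero: an SSD without the conditions on its size and on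
pairs of columns, which the lower bounds for `E(s²)` do not need. -/
structure IsBalanced {N m : ℕ} (D : Matrix (Fin N) (Fin m) ℤ) : Prop where
  entries : ∀ i j, D i j = 1 ∨ D i j = -1
  sum_col : ∀ j, ∑ i, D i j = 0

variable {N m : ℕ} {D : Matrix (Fin N) (Fin m) ℤ}

theorem IsSSD.isBalanced (h : IsSSD D) : IsBalanced D :=
  ⟨h.entries, fun j => (sum_eq_zero_iff_card_eq_card fun i => h.entries i j).2 (h.balanced j)⟩

theorem gram_apply (D : Matrix (Fin N) (Fin m) ℤ) (i j : Fin m) :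
    gram D i j = ∑ k, D k i * D k j := by
  simp only [gram, Matrix.mul_apply, Matrix.transpose_apply]

theorem gram_comm (D : Matrix (Fin N) (Fin m) ℤ) (i j : Fin m) : gram D i j = gram D j i := by
  simp only [gram_apply, mul_comm]

theorem gram_self (hD : ∀ i j, D i j = 1 ∨ D i j = -1) (j : Fin m) : gram D j j = N := by
  rw [gram_apply, sum_mul_self_eq_card fun k => hD k j, Fintype.card_fin]

namespace IsBalanced

theorem four_dvd_gram_add (h : IsBalanced D) (i j : Fin m) : 4 ∣ gram D i j + N := by
  simpa [h.sum_col, gram_apply] using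
    four_dvd_sum_mul_sub (fun k => h.entries k i) (fun k => h.entries k j)

theorem natAbs_gram_mod_four (h : IsBalanced D) (i j : Fin m) :
    (gram D i j).natAbs % 4 = N % 4 := by
  have even_rows : (2 : ℤ) ∣ N := by
    simpa [h.sum_col] using two_dvd_sum_sub_card fun k => h.entries k i
  have := h.four_dvd_gram_add i j
  omega

theorem sum_sq_mul_transpose (h : IsBalanced D) :
    ∑ k, ∑ l, (D * Dᵀ) k l ^ 2 = 2 * pairSum D + m * N ^ 2 := by
  have := sum_sum_eq_sum_diag_add_two_mul_sum_columnPairs (f := fun i j => gram D i j ^ 2)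
    fun i j => by rw [gram_comm]
  rw [← sum_sq_transpose_mul_self, ← gram, this, add_comm, pairSum]
  simp [gram_self h.entries]

end IsBalanced

end BalancedDesigns

section TwoClasses

/-- An integer matrix with all off-diagonal entries `2` modulo `4` between indices on the same side
of `s`, and `0` modulo `4` between an index in `s` and one outside `s`. -/
structure IsTwoClass {ι : Type*} (U : Matrix ι ι ℤ) (s : Finset ι) : Prop where
  same : ∀ k l, k ≠ l → (k ∈ s ↔ l ∈ s) → U k l % 4 = 2
  cross : ∀ k l, ¬(k ∈ s ↔ l ∈ s) → U k l % 4 = 0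

variable {ι : Type*} [DecidableEq ι] {U : Matrix ι ι ℤ} {s : Finset ι} {a σ : ℤ}

theorem four_le_sq_of_emod_four_eq_two {u : ℤ} (hu : u % 4 = 2) : 4 ≤ u ^ 2 := by
  have : u ≤ -2 ∨ 2 ≤ u := by omega
  rcases this with h | h <;> nlinarith

theorem neg_four_mul_le_sq_of_emod_four_eq_zero {u : ℤ} (hσ : |σ| ≤ 1) (hu : u % 4 = 0) :
    -4 * σ * u ≤ u ^ 2 := by
  obtain ⟨t, rfl⟩ := Int.dvd_of_emod_eq_zero hu
  have : 0 ≤ t * (t + σ) := by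
    obtain ⟨h₁, h₂⟩ := abs_le.1 hσ
    rcases lt_trichotomy t 0 with h | rfl | h <;> nlinarith
  linarith

/-- The terms with the factor `-4 * σ` are linear in the entries, so that they cancel in the sum
over a matrix with zero row sums. -/
theorem IsTwoClass.le_sq (h : IsTwoClass U s) (hσ : |σ| ≤ 1) (hdiag : ∀ k, U k k = a) (k l : ι)
    {α : ι → ℤ} (hα : ∀ k, α k = if k ∈ s then 1 else 0) :
    -4 * σ * (α k * U k l) + -4 * σ * (α l * U k l) + (4 - 16 * σ ^ 2) * (α k * α l) +
        4 * ((1 - α k) * (1 - α l)) +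
        (if k = l then a ^ 2 - 4 + (8 * σ * a + 16 * σ ^ 2) * α k else 0) ≤ U k l ^ 2 := by
  rcases eq_or_ne k l with rfl | hkl
  · rw [hdiag, hα, if_pos rfl]
    split_ifs <;> linarith
  · have same := h.same k l hkl
    have cross := h.cross k l
    rw [hα, hα, if_neg hkl]
    by_cases hk : k ∈ s <;> by_cases hl : l ∈ s <;>
      simp only [hk, hl, if_true, if_false, true_implies, not_true, not_false_iff, iff_true,
        iff_false] at same cross ⊢
    · have := four_le_sq_of_emod_four_eq_two (u := U k l + 4 * σ) (by omega)
      linarith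
    · linarith [neg_four_mul_le_sq_of_emod_four_eq_zero hσ cross]
    · linarith [neg_four_mul_le_sq_of_emod_four_eq_zero hσ cross]
    · linarith [four_le_sq_of_emod_four_eq_two same]

theorem IsTwoClass.compl [Fintype ι] (h : IsTwoClass U s) : IsTwoClass U sᶜ :=
  ⟨fun k l hkl hs => h.same k l hkl (by simpa only [mem_compl, not_iff_not] using hs),
    fun k l hs => h.cross k l (by simpa only [mem_compl, not_iff_not] using hs)⟩

theorem IsTwoClass.le_sum_sq [Fintype ι] (h : IsTwoClass U s) (hσ : |σ| ≤ 1)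
    (hdiag : ∀ k, U k k = a) (hsymm : U.IsSymm) (hrow : ∀ k, ∑ l, U k l = 0) :
    Fintype.card ι * a ^ 2 + 8 * #s * (σ * a) + (4 - 16 * σ ^ 2) * #s * (#s - 1) +
        4 * #sᶜ * (#sᶜ - 1) ≤ ∑ k, ∑ l, U k l ^ 2 := by
  obtain ⟨α, hα⟩ : ∃ α : ι → ℤ, ∀ k, α k = if k ∈ s then 1 else 0 := ⟨_, fun _ => rfl⟩
  have sum_α : ∑ k, α k = #s := by simp [hα]
  have row_terms : ∑ k, ∑ l, α k * U k l = 0 := by simp [← mul_sum, hrow]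
  have col_terms : ∑ k, ∑ l, α l * U k l = 0 := by
    rw [sum_comm, ← row_terms]
    simp only [hsymm.apply]
  refine le_trans (le_of_eq ?_)
    (sum_le_sum fun k _ => sum_le_sum fun l _ => h.le_sq hσ hdiag k l hα)
  rw [card_compl, Nat.cast_sub (card_le_univ s)]
  simp only [sum_add_distrib, ← mul_sum (a := -4 * σ), row_terms, col_terms]
  simp only [← mul_sum, ← sum_mul, sum_ite_eq, mem_univ, if_true, sum_add_distrib,
    sum_sub_distrib, sum_const, card_univ, nsmul_eq_mul, sum_α]
  ring

end TwoClasses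

section RowGram

/-- `DDᵀ + q (J - N I)` with `J` the all-ones matrix. For balanced `D` its rows still sum to zero,
and its diagonal entries are `m - q (N - 1)`. -/
def shiftedRowGram {N m : ℕ} (D : Matrix (Fin N) (Fin m) ℤ) (q : ℤ) : Matrix (Fin N) (Fin N) ℤ :=
  Matrix.of fun k l => (D * Dᵀ) k l + q - if k = l then q * N else 0

/-- The rows of a sign matrix with an odd number of entries `-1`. -/
def oddRows {N m : ℕ} (D : Matrix (Fin N) (Fin m) ℤ) : Finset (Fin N) :=
  {k | (∑ j, D k j - m) % 4 = 2}

/-- The difference in size between the rows with an odd and those with an even number of entries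
`-1`. -/
def rowImbalance {N m : ℕ} (D : Matrix (Fin N) (Fin m) ℤ) : ℤ :=
  |2 * #(oddRows D) - N|

variable {N m : ℕ} {D : Matrix (Fin N) (Fin m) ℤ}

theorem rowImbalance_nonneg (D : Matrix (Fin N) (Fin m) ℤ) : 0 ≤ rowImbalance D :=
  abs_nonneg _

theorem rowImbalance_le (D : Matrix (Fin N) (Fin m) ℤ) : rowImbalance D ≤ N := by
  have : #(oddRows D) ≤ N := by simpa using card_le_univ (oddRows D)
  rw [rowImbalance, abs_le]
  omega

theorem shiftedRowGram_isSymm (D : Matrix (Fin N) (Fin m) ℤ) (q : ℤ) :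
    (shiftedRowGram D q).IsSymm := by
  ext k l
  simp only [shiftedRowGram, Matrix.transpose_apply, Matrix.of_apply, Matrix.mul_apply, mul_comm,
    eq_comm]

namespace IsBalanced

theorem mul_transpose_self (h : IsBalanced D) (k : Fin N) : (D * Dᵀ) k k = m := by
  simp only [Matrix.mul_apply, Matrix.transpose_apply, sum_mul_self_eq_card (h.entries k),
    Fintype.card_fin]

theorem sum_row_mul_transpose (h : IsBalanced D) (k : Fin N) : ∑ l, (D * Dᵀ) k l = 0 := by
  simp only [Matrix.mul_apply, Matrix.transpose_apply]
  rw [sum_comm]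
  simp only [← mul_sum, h.sum_col, mul_zero, sum_const_zero]

theorem shiftedRowGram_self (h : IsBalanced D) (q : ℤ) (k : Fin N) :
    shiftedRowGram D q k k = m - q * (N - 1) := by
  simp only [shiftedRowGram, Matrix.of_apply, h.mul_transpose_self, if_true]
  ring

theorem sum_row_shiftedRowGram (h : IsBalanced D) (q : ℤ) (k : Fin N) :
    ∑ l, shiftedRowGram D q k l = 0 := by
  simp [shiftedRowGram, sum_sub_distrib, sum_add_distrib, h.sum_row_mul_transpose, mul_comm]

theorem sum_sq_shiftedRowGram (h : IsBalanced D) (q : ℤ) :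
    ∑ k, ∑ l, shiftedRowGram D q k l ^ 2 = 2 * pairSum D -
      ((m + q) ^ 2 * N - q ^ 2 * N ^ 2 - m * N ^ 2) + N * (m - q * (N - 1)) ^ 2 := by
  have sq_apply (k l) : shiftedRowGram D q k l ^ 2 = (D * Dᵀ) k l ^ 2 + 2 * q * (D * Dᵀ) k l +
      q ^ 2 + if k = l then (q * N) ^ 2 - 2 * (q * N) * ((D * Dᵀ) k l + q) else 0 := by
    rw [shiftedRowGram, Matrix.of_apply]
    split_ifs <;> ring
  simp only [sq_apply, sum_add_distrib, h.sum_sq_mul_transpose, ← mul_sum,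
    h.sum_row_mul_transpose, h.mul_transpose_self, sum_ite_eq, mem_univ, if_true, sum_const,
    card_univ, Fintype.card_fin, nsmul_eq_mul]
  ring

theorem isTwoClass_shiftedRowGram (h : IsBalanced D) {q : ℤ} (hq : (m + q) % 4 = 2) :
    IsTwoClass (shiftedRowGram D q) (oddRows D) := by
  have apply_emod (k l) (hkl : k ≠ l) :
      (shiftedRowGram D q k l - (∑ j, D k j + ∑ j, D l j - m + q)) % 4 = 0 := by
    have := four_dvd_sum_mul_sub (h.entries k) (h.entries l)
    simp only [shiftedRowGram, Matrix.of_apply, Matrix.mul_apply, Matrix.transpose_apply, hkl,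
      if_false, Fintype.card_fin] at this ⊢
    omega
  have even_sub (k) : 2 ∣ ∑ j, D k j - m := by
    simpa only [Fintype.card_fin] using two_dvd_sum_sub_card (h.entries k)
  refine ⟨fun k l hkl hs => ?_, fun k l hs => ?_⟩
  · have := apply_emod k l hkl
    have := even_sub k
    have := even_sub l
    simp only [oddRows, mem_filter, mem_univ, true_and] at hs
    omega
  · have := apply_emod k l fun hkl => hs (by rw [hkl])
    have := even_sub k
    have := even_sub l
    simp only [oddRows, mem_filter, mem_univ, true_and] at hs
    omega

theorem four_dvd_mul_add_card_oddRows (h : IsBalanced D) :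
    (4 : ℤ) ∣ N * m + 2 * #(oddRows D) := by
  have row_dvd (k) : 4 ∣ ∑ j, D k j - m + 2 * if k ∈ oddRows D then 1 else 0 := by
    have := two_dvd_sum_sub_card (h.entries k)
    simp only [oddRows, mem_filter, mem_univ, true_and, Fintype.card_fin] at this ⊢
    split_ifs <;> omega
  have sum_entries : ∑ k, ∑ j, D k j = 0 :=
    sum_comm.trans (sum_eq_zero fun j _ => h.sum_col j)
  have := dvd_sum fun k (_ : k ∈ univ) => row_dvd k
  simp only [sum_add_distrib, sum_sub_distrib, sum_entries, ← mul_sum, sum_ite_mem, univ_inter,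
    sum_const, card_univ, Fintype.card_fin, nsmul_eq_mul, mul_one] at this
  omega

theorem two_dvd_add_card_oddRows (h : IsBalanced D) (hN : N % 4 = 2) :
    2 ∣ m + #(oddRows D) := by
  obtain ⟨t, ht⟩ : ∃ t : ℤ, N = 4 * t + 2 := ⟨N / 4, by omega⟩
  obtain ⟨u, hu⟩ := h.four_dvd_mul_add_card_oddRows
  rw [ht] at hu
  have : (2 : ℤ) ∣ m + #(oddRows D) := ⟨u - t * m, by linarith⟩
  exact_mod_cast this

theorem two_le_rowImbalance (h : IsBalanced D) (hN : N % 4 = 2) (hm : m % 2 = 0) :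
    2 ≤ rowImbalance D := by
  have := h.two_dvd_add_card_oddRows hN
  rw [rowImbalance, le_abs']
  omega

theorem rowImbalance_add_two_le (h : IsBalanced D) (hN : N % 4 = 2) (hm : m % 2 = 1) :
    rowImbalance D + 2 ≤ N := by
  have := h.two_dvd_add_card_oddRows hN
  have : #(oddRows D) ≤ N := by simpa using card_le_univ (oddRows D)
  rw [rowImbalance, ← le_sub_iff_add_le, abs_le]
  omega

end IsBalanced

end RowGram

section RyanBulutogluBound

/-- The second lower bound for `2 * pairSum D - rbG N m q`, for `N = n`, `rbDist N m q = a` and row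
imbalance `t`. It is concave in `t`, so that its minimum over an interval is at an end point. -/
def imbalanceBound (n a t : ℚ) : ℚ :=
  4 * n * a - 2 * n ^ 2 + 4 * n + (8 * n - 8 - 4 * a) * t - 2 * t ^ 2

theorem imbalanceBound_left_le {n a t₀ t t₁ : ℚ} (h : 2 * (t₀ + t₁) ≤ 8 * n - 8 - 4 * a)
    (h₀ : t₀ ≤ t) (h₁ : t ≤ t₁) : imbalanceBound n a t₀ ≤ imbalanceBound n a t := by
  simp only [imbalanceBound]
  have : 0 ≤ (t - t₀) * (8 * n - 8 - 4 * a - 2 * (t + t₀)) :=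
    mul_nonneg (by linarith) (by linarith)
  linarith

theorem imbalanceBound_right_le {n a t₀ t t₁ : ℚ} (h : 8 * n - 8 - 4 * a ≤ 2 * (t₀ + t₁))
    (h₀ : t₀ ≤ t) (h₁ : t ≤ t₁) : imbalanceBound n a t₁ ≤ imbalanceBound n a t := by
  simp only [imbalanceBound]
  have : 0 ≤ (t₁ - t) * (2 * (t + t₁) - (8 * n - 8 - 4 * a)) :=
    mul_nonneg (by linarith) (by linarith)
  linarith

theorem exists_sq_eq_of_emod_four_eq_two {u : ℤ} (hu : u % 4 = 2) :
    ∃ k : ℕ, u ^ 2 = 4 + 32 * (k : ℤ) := by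
  obtain ⟨t, rfl⟩ : ∃ t, u = 4 * t + 2 := ⟨u / 4, by omega⟩
  obtain ⟨s, hs⟩ := (Int.even_mul_succ_self t).two_dvd
  have : 0 ≤ t * (t + 1) := by
    rcases le_or_gt 0 t with ht | ht <;> nlinarith
  lift s to ℕ using by omega
  exact ⟨s, by linear_combination 16 * hs⟩

variable {N m q : ℕ} {D : Matrix (Fin N) (Fin m) ℤ}

namespace IsBalanced

theorem le_two_mul_pairSum (h : IsBalanced D) (hq : (m + q) % 4 = 2) {σ : ℤ} (hσ : |σ| ≤ 1)
    {s : Finset (Fin N)} (hs : s = oddRows D ∨ s = (oddRows D)ᶜ) :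
    (m + q) ^ 2 * N - q ^ 2 * N ^ 2 - m * N ^ 2 + 8 * #s * (σ * (m - q * (N - 1))) +
      (4 - 16 * σ ^ 2) * #s * (#s - 1) + 4 * (N - #s) * (N - #s - 1) ≤ 2 * pairSum D := by
  have twoClass : IsTwoClass (shiftedRowGram D q) s := by
    have := h.isTwoClass_shiftedRowGram (q := q) (by omega)
    rcases hs with rfl | rfl
    exacts [this, this.compl]
  have := twoClass.le_sum_sq hσ (h.shiftedRowGram_self q) (shiftedRowGram_isSymm D q)
    (h.sum_row_shiftedRowGram q)
  rw [h.sum_sq_shiftedRowGram, card_compl, Nat.cast_sub (card_le_univ s), Fintype.card_fin] at this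
  linarith

theorem rbG_add_sq_le (h : IsBalanced D) (hq : (m + q) % 4 = 2) :
    rbG N m q + 2 * N ^ 2 - 4 * N + 2 * (rowImbalance D : ℚ) ^ 2 ≤ 2 * pairSum D := by
  have := h.le_two_mul_pairSum hq (σ := 0) (by norm_num) (Or.inl rfl)
  have bound : ((m + q) ^ 2 * N - q ^ 2 * N ^ 2 - m * N ^ 2 + 2 * N ^ 2 - 4 * N +
      2 * rowImbalance D ^ 2 : ℤ) ≤ 2 * pairSum D := by
    rw [rowImbalance, sq_abs]
    linarith
  rw [rbG]
  exact_mod_cast bound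

theorem rbG_add_imbalanceBound_le (h : IsBalanced D) (hq : (m + q) % 4 = 2) :
    rbG N m q + imbalanceBound N (rbDist N m q) (rowImbalance D) ≤ 2 * pairSum D := by
  obtain ⟨σ, hσ, hσa⟩ : ∃ σ : ℤ, (σ = 1 ∨ σ = -1) ∧
      |(m - q * (N - 1) : ℤ)| = σ * (m - q * (N - 1)) := by
    rcases abs_choice (m - q * (N - 1) : ℤ) with h | h <;> rw [h]
    exacts [⟨1, by simp⟩, ⟨-1, by simp⟩]
  have abs_σ : |σ| ≤ 1 := by rcases hσ with rfl | rfl <;> simp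
  have sq_σ : σ ^ 2 = 1 := by rcases hσ with rfl | rfl <;> simp
  -- The bound comes from the smaller of the two classes of rows.
  obtain ⟨s, hs, card_s⟩ : ∃ s, (s = oddRows D ∨ s = (oddRows D)ᶜ) ∧
      (N : ℤ) - 2 * #s = rowImbalance D := by
    have := card_add_card_compl (oddRows D)
    rw [Fintype.card_fin] at this
    rcases abs_choice (2 * #(oddRows D) - N : ℤ) with h | h
    · exact ⟨_, Or.inr rfl, by rw [rowImbalance, h]; omega⟩
    · exact ⟨_, Or.inl rfl, by rw [rowImbalance, h]; omega⟩
  have := h.le_two_mul_pairSum hq abs_σ hs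
  have dist_eq : rbDist N m q = (|(m - q * (N - 1) : ℤ)| : ℤ) := by
    rw [rbDist]
    push_cast
    rfl
  rw [sq_σ, ← hσa] at this
  have thisQ : ((m + q) ^ 2 * N - q ^ 2 * N ^ 2 - m * N ^ 2 + 8 * #s * rbDist N m q +
      (4 - 16 * 1) * #s * (#s - 1) + 4 * (N - #s) * (N - #s - 1) : ℚ) ≤ 2 * pairSum D := by
    rw [dist_eq]
    exact_mod_cast this
  rw [rbG, imbalanceBound, ← card_s]
  push_cast
  linarith

theorem rbG_add_imbalanceBound_left_le (h : IsBalanced D) (hq : (m + q) % 4 = 2) {t₀ t₁ : ℚ}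
    (h₀ : t₀ ≤ rowImbalance D) (h₁ : rowImbalance D ≤ t₁)
    (ha : 2 * (t₀ + t₁) ≤ 8 * N - 8 - 4 * rbDist N m q) :
    rbG N m q + imbalanceBound N (rbDist N m q) t₀ ≤ 2 * pairSum D :=
  (add_le_add_right (imbalanceBound_left_le ha h₀ h₁) _).trans (h.rbG_add_imbalanceBound_le hq)

theorem rbG_add_imbalanceBound_right_le (h : IsBalanced D) (hq : (m + q) % 4 = 2) {t₀ t₁ : ℚ}
    (h₀ : t₀ ≤ rowImbalance D) (h₁ : rowImbalance D ≤ t₁)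
    (ha : 8 * N - 8 - 4 * rbDist N m q ≤ 2 * (t₀ + t₁)) :
    rbG N m q + imbalanceBound N (rbDist N m q) t₁ ≤ 2 * pairSum D :=
  (add_le_add_right (imbalanceBound_right_le ha h₀ h₁) _).trans (h.rbG_add_imbalanceBound_le hq)

theorem rbBoundZero_le_Es2 (h : IsBalanced D) (hq : (m + q) % 4 = 2) :
    rbBoundZero N m q ≤ Es2 D := by
  have h₀ : (0 : ℚ) ≤ rowImbalance D := mod_cast rowImbalance_nonneg D
  have h₁ : (rowImbalance D : ℚ) ≤ N := mod_cast rowImbalance_le D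
  rw [rbBoundZero]
  split_ifs
  · exact div_le_Es2 ((h.rbG_add_sq_le hq).trans' (by linarith [sq_nonneg (rowImbalance D : ℚ)]))
  · refine div_le_Es2 ((h.rbG_add_imbalanceBound_left_le hq h₀ h₁ (by linarith)).trans' ?_)
    rw [imbalanceBound]
    linarith
  · refine div_le_Es2 ((h.rbG_add_imbalanceBound_right_le hq h₀ h₁ (by linarith)).trans' ?_)
    rw [imbalanceBound]
    linarith

theorem rbH_le_Es2_of_even (h : IsBalanced D) (hN : N % 4 = 2) (hq : (m + q) % 4 = 2)
    (hq₂ : q % 2 = 0) : rbH N m q ≤ Es2 D := by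
  have h₀ : (2 : ℚ) ≤ rowImbalance D := mod_cast h.two_le_rowImbalance hN (by omega)
  have h₁ : (rowImbalance D : ℚ) ≤ N := mod_cast rowImbalance_le D
  rw [rbH, if_pos hq₂]
  split_ifs
  · exact div_le_Es2 ((h.rbG_add_sq_le hq).trans' (by nlinarith))
  · refine div_le_Es2 ((h.rbG_add_imbalanceBound_left_le hq h₀ h₁ (by linarith)).trans' ?_)
    rw [imbalanceBound]
    linarith
  · refine div_le_Es2 ((h.rbG_add_imbalanceBound_right_le hq h₀ h₁ (by linarith)).trans' ?_)
    rw [imbalanceBound]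
    linarith

theorem rbH_le_Es2_of_odd (h : IsBalanced D) (hN : N % 4 = 2) (hq : (m + q) % 4 = 2)
    (hq₂ : q % 2 = 1) : rbH N m q ≤ Es2 D := by
  have h₀ : (0 : ℚ) ≤ rowImbalance D := mod_cast rowImbalance_nonneg D
  have h₁ : (rowImbalance D : ℚ) ≤ N - 2 := by
    rw [le_sub_iff_add_le]
    exact_mod_cast h.rowImbalance_add_two_le hN (by omega)
  rw [rbH, if_neg (by omega)]
  split_ifs
  · exact div_le_Es2 ((h.rbG_add_sq_le hq).trans' (by linarith [sq_nonneg (rowImbalance D : ℚ)]))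
  · refine div_le_Es2 ((h.rbG_add_imbalanceBound_left_le hq h₀ h₁ (by linarith)).trans' ?_)
    rw [imbalanceBound]
    linarith
  · refine div_le_Es2 ((h.rbG_add_imbalanceBound_right_le hq h₀ h₁ (by linarith)).trans' ?_)
    rw [imbalanceBound]
    linarith

theorem rbH_le_Es2 (h : IsBalanced D) (hN : N % 4 = 2) (hq : (m + q) % 4 = 2) :
    rbH N m q ≤ Es2 D :=
  (Nat.mod_two_eq_zero_or_one q).elim (h.rbH_le_Es2_of_even hN hq) (h.rbH_le_Es2_of_odd hN hq)

theorem exists_pairSum_eq (h : IsBalanced D) (hN : N % 4 = 2) :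
    ∃ k : ℕ, pairSum D = 4 * #(columnPairs m) + 32 * k := by
  have gram_emod_four (i j) : gram D i j % 4 = 2 := by
    have := h.four_dvd_gram_add i j
    omega
  choose k hk using fun p : Fin m × Fin m => exists_sq_eq_of_emod_four_eq_two
    (gram_emod_four p.1 p.2)
  refine ⟨∑ p ∈ columnPairs m, k p, ?_⟩
  simp only [pairSum, hk, sum_add_distrib, sum_const, nsmul_eq_mul, Nat.cast_sum, mul_sum]
  ring

theorem rbBoundTwo_le_Es2 (h : IsBalanced D) (hN : N % 4 = 2) (hq : (m + q) % 4 = 2) :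
    rbBoundTwo N m q ≤ Es2 D := by
  obtain ⟨k, hk⟩ := h.exists_pairSum_eq hN
  have pairSum_eq : 2 * pairSum D = 4 * (m * (m - 1)) + 64 * (k : ℚ) := by
    rw [hk, ← two_mul_card_columnPairs]
    push_cast
    ring
  have ceil_le : ⌈(m : ℚ) * (m - 1) * (rbH N m q - 4) / 64⌉ ≤ k := by
    have := mul_le_mul_of_nonneg_left (h.rbH_le_Es2 hN hq) (cast_mul_pred_nonneg m)
    rw [mul_Es2_eq, pairSum_eq] at this
    rw [Int.ceil_le]
    push_cast
    linarith
  have max_le : ((max 0 ⌈(m : ℚ) * (m - 1) * (rbH N m q - 4) / 64⌉ : ℤ) : ℚ) ≤ k := by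
    exact_mod_cast max_le (Int.natCast_nonneg k) ceil_le
  exact div_le_Es2 (by linarith)

theorem rbBound_le_Es2 (h : IsBalanced D) (hN : N % 2 = 0) (hq : (m + q) % 4 = 2) :
    rbBound N m q ≤ Es2 D := by
  rw [rbBound]
  split_ifs with hN₄
  exacts [h.rbBoundZero_le_Es2 hq, h.rbBoundTwo_le_Es2 (by omega) hq]

end IsBalanced

end RyanBulutogluBound

section Optimality

variable {N m s : ℕ} {D : Matrix (Fin N) (Fin m) ℤ}

theorem IsSSD.rows_mod_two (h : IsSSD D) : N % 2 = 0 := by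
  rcases m.eq_zero_or_pos with rfl | hm
  · simp [Nat.le_zero.1 h.rows_le_cols]
  · have := two_dvd_sum_sub_card fun i => h.entries i ⟨0, hm⟩
    rw [h.isBalanced.sum_col, Fintype.card_fin] at this
    omega

theorem AttainsRBBound.isEs2Optimal (h : AttainsRBBound D) (hD : IsSSD D) : IsEs2Optimal D := by
  obtain ⟨q, hq, es2_eq⟩ := h
  refine ⟨hD, fun D' hD' => not_lt.2 ?_⟩
  rw [es2_eq]
  exact hD'.isBalanced.rbBound_le_Es2 hD.rows_mod_two ((hq q).2 rfl).2.2

theorem natAbs_gram_le_sMax (D : Matrix (Fin N) (Fin m) ℤ) {p : Fin m × Fin m}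
    (hp : p ∈ columnPairs m) : (gram D p.1 p.2).natAbs ≤ sMax D :=
  le_sup (f := fun p : Fin m × Fin m => (gram D p.1 p.2).natAbs) hp

theorem exists_natAbs_gram_eq_sMax (D : Matrix (Fin N) (Fin m) ℤ) (hm : (columnPairs m).Nonempty) :
    ∃ p ∈ columnPairs m, (gram D p.1 p.2).natAbs = sMax D :=
  (exists_mem_eq_sup _ hm _).imp fun _ hp => ⟨hp.1, hp.2.symm⟩

theorem IsBalanced.sMax_mod_four (h : IsBalanced D) (hm : (columnPairs m).Nonempty) :
    sMax D % 4 = N % 4 := by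
  obtain ⟨p, -, hp⟩ := exists_natAbs_gram_eq_sMax D hm
  rw [← hp, h.natAbs_gram_mod_four]

theorem IsBalanced.sMax_le_natAbs_gram_add_four (h : IsBalanced D) (hs : sMax D ≤ 6)
    {p : Fin m × Fin m} (hp : p ∈ columnPairs m) : sMax D ≤ (gram D p.1 p.2).natAbs + 4 := by
  have := natAbs_gram_le_sMax D hp
  have := h.natAbs_gram_mod_four p.1 p.2
  have := h.sMax_mod_four ⟨p, hp⟩
  omega

/-- The sum of `s_ij²` if `|s_ij| = s` for `f` pairs `i < j` and `|s_ij| = s - 4` for the others,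
where `s - 4` is truncated at `0`. -/
def twoValuedSum (m s f : ℕ) : ℤ :=
  #(columnPairs m) * (s - 4 : ℕ) ^ 2 + f * (s ^ 2 - (s - 4 : ℕ) ^ 2)

theorem twoValuedSum_lt {f f' : ℕ} (hs : 0 < s) (hf : f' < f) :
    twoValuedSum m s f' < twoValuedSum m s f := by
  have sq_lt : ((s - 4 : ℕ) ^ 2 : ℤ) < s ^ 2 := by
    exact_mod_cast Nat.pow_lt_pow_left (show s - 4 < s by omega) two_ne_zero
  have : (f' : ℤ) < f := mod_cast hf
  exact Int.add_lt_add_left (mul_lt_mul_of_pos_right this (sub_pos.2 sq_lt)) _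

theorem twoValuedSum_eq_sum (D : Matrix (Fin N) (Fin m) ℤ) (s : ℕ) :
    twoValuedSum m s #{p ∈ columnPairs m | (gram D p.1 p.2).natAbs = s} =
      ∑ p ∈ columnPairs m, ((if (gram D p.1 p.2).natAbs = s then s else s - 4 : ℕ) : ℤ) ^ 2 := by
  have apply_eq (p : Fin m × Fin m) :
      ((if (gram D p.1 p.2).natAbs = s then s else s - 4 : ℕ) : ℤ) ^ 2 = (s - 4 : ℕ) ^ 2 +
        (if (gram D p.1 p.2).natAbs = s then 1 else 0) * (s ^ 2 - (s - 4 : ℕ) ^ 2) := by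
    split_ifs <;> ring
  simp only [apply_eq, sum_add_distrib, ← sum_mul, sum_boole, sum_const, nsmul_eq_mul,
    twoValuedSum]

theorem IsBalanced.pairSum_le_twoValuedSum (h : IsBalanced D) (hs : sMax D ≤ s)
    (hsN : s % 4 = N % 4) :
    pairSum D ≤ twoValuedSum m s #{p ∈ columnPairs m | (gram D p.1 p.2).natAbs = s} := by
  rw [twoValuedSum_eq_sum, pairSum]
  refine sum_le_sum fun p hp => ?_
  rw [← Int.natAbs_sq]
  have := natAbs_gram_le_sMax D hp
  have := h.natAbs_gram_mod_four p.1 p.2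
  gcongr
  split_ifs <;> omega

theorem twoValuedSum_freqSMax_le_pairSum
    (hD : ∀ p ∈ columnPairs m, sMax D ≤ (gram D p.1 p.2).natAbs + 4) :
    twoValuedSum m (sMax D) (freqSMax D) ≤ pairSum D := by
  rw [freqSMax, twoValuedSum_eq_sum, pairSum]
  refine sum_le_sum fun p hp => ?_
  rw [← Int.natAbs_sq (gram D p.1 p.2)]
  have := hD p hp
  gcongr
  split_ifs <;> omega

theorem IsEs2Optimal.isMinimaxOptimal (h : IsEs2Optimal D)
    (hD : ∀ p ∈ columnPairs m, sMax D ≤ (gram D p.1 p.2).natAbs + 4) : IsMinimaxOptimal D := by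
  refine ⟨h.1, fun D' hD' smaller => ?_⟩
  have sMax_le : sMax D' ≤ sMax D := smaller.elim le_of_lt fun h => h.1.le
  have freq_lt : #{p ∈ columnPairs m | (gram D' p.1 p.2).natAbs = sMax D} < freqSMax D := by
    rcases smaller with sMax_lt | ⟨sMax_eq, freq_lt⟩
    · have hm : (columnPairs m).Nonempty := by
        rw [nonempty_iff_ne_empty]
        intro hm
        simp [sMax, hm] at sMax_lt
      obtain ⟨p, hp, p_eq⟩ := exists_natAbs_gram_eq_sMax D hm
      rw [filter_false_of_mem fun p hp => ((natAbs_gram_le_sMax D' hp).trans_lt sMax_lt).ne]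
      exact card_pos.2 ⟨p, mem_filter.2 ⟨hp, p_eq⟩⟩
    · rwa [← sMax_eq]
  obtain ⟨p, hp, p_ne⟩ : ∃ p ∈ columnPairs m, (gram D' p.1 p.2).natAbs ≠ sMax D := by
    by_contra! all_eq
    rw [filter_true_of_mem all_eq] at freq_lt
    exact freq_lt.not_ge (card_filter_le _ _)
  have sMax_pos : 0 < sMax D :=
    (((natAbs_gram_le_sMax D' hp).trans sMax_le).lt_of_ne p_ne).pos
  refine (pairSum_le_pairSum_of_Es2_le (not_lt.1 (h.2 D' hD'))).not_gt ?_
  calc pairSum D'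
      ≤ twoValuedSum m (sMax D) #{p ∈ columnPairs m | (gram D' p.1 p.2).natAbs = sMax D} :=
        hD'.isBalanced.pairSum_le_twoValuedSum sMax_le (h.1.isBalanced.sMax_mod_four ⟨p, hp⟩)
    _ < twoValuedSum m (sMax D) (freqSMax D) := twoValuedSum_lt sMax_pos freq_lt
    _ ≤ pairSum D := twoValuedSum_freqSMax_le_pairSum hD

end Optimality

section Designs

variable {N m : ℕ}

theorem natAbs_gram_lt_of_sMax_lt {D : Matrix (Fin N) (Fin m) ℤ} (hD : sMax D < N) {j k : Fin m}
    (hjk : j ≠ k) : (gram D j k).natAbs < N := by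
  rcases hjk.lt_or_gt with h | h
  · exact (natAbs_gram_le_sMax D (p := (j, k)) (by simpa [columnPairs])).trans_lt hD
  · rw [gram_comm]
    exact (natAbs_gram_le_sMax D (p := (k, j)) (by simpa [columnPairs])).trans_lt hD

theorem isSSD_of_sMax_lt {D : Matrix (Fin N) (Fin m) ℤ} (hNm : N ≤ m)
    (entries : ∀ i j, D i j = 1 ∨ D i j = -1)
    (balanced : ∀ j, #{i | D i j = 1} = #{i | D i j = -1}) (hs : sMax D < N) : IsSSD D := by
  refine ⟨hNm, entries, balanced, fun j k hjk col_eq => ?_, fun j k hjk col_eq => ?_⟩ <;>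
    refine (natAbs_gram_lt_of_sMax_lt hs hjk).ne ?_
  · have entry_eq (i) : D i j = D i k := congr_fun col_eq i
    have gram_eq : gram D j k = gram D k k := by simp only [gram_apply, entry_eq]
    rw [gram_eq, gram_self entries, Int.natAbs_natCast]
  · have entry_eq (i) : D i j = -D i k := congr_fun col_eq i
    have gram_eq : gram D j k = -gram D k k := by
      simp only [gram_apply, entry_eq, neg_mul, sum_neg_distrib]
    rw [gram_eq, gram_self entries, Int.natAbs_neg, Int.natAbs_natCast]

theorem signMatrix_eq_one_or_neg_one (rows : List ℕ) (i : Fin N) (j : Fin m) :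
    signMatrix N m rows i j = 1 ∨ signMatrix N m rows i j = -1 :=
  ite_eq_or_eq _ _ _

theorem IsRBIndex.unique {q q' : ℕ} (h : IsRBIndex N m q) (h' : IsRBIndex N m q') : q' = q := by
  wlog hqq : q < q' generalizing q q'
  · rcases (not_lt.1 hqq).eq_or_lt with rfl | hlt
    exacts [rfl, (this h' h hlt).symm]
  obtain ⟨-, upper, mod_four⟩ := h
  obtain ⟨lower, -, mod_four'⟩ := h'
  have : (q : ℤ) + 4 ≤ q' := by omega
  nlinarith

instance (N m q : ℕ) : Decidable (IsRBIndex N m q) :=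
  inferInstanceAs (Decidable (_ ∧ _ ∧ _))

theorem isOptimalDesign_signMatrix {rows : List ℕ} {s f q : ℕ} {e : ℚ}
    (size : N ≤ m ∧ s < N ∧ s ≤ 6) (bound : IsRBIndex N m q ∧ rbBound N m q = e)
    (balanced : ∀ j, #{i | signMatrix N m rows i j = 1} = #{i | signMatrix N m rows i j = -1})
    (values : sMax (signMatrix N m rows) = s ∧ freqSMax (signMatrix N m rows) = f ∧
      Es2 (signMatrix N m rows) = e) :
    IsOptimalDesign (signMatrix N m rows) s f e := by
  obtain ⟨rows_le_cols, s_lt, s_le⟩ := size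
  obtain ⟨rbIndex, rbBound_eq⟩ := bound
  obtain ⟨sMax_eq, freqSMax_eq, es2_eq⟩ := values
  have isSSD : IsSSD (signMatrix N m rows) :=
    isSSD_of_sMax_lt rows_le_cols (signMatrix_eq_one_or_neg_one rows) balanced
      (sMax_eq.trans_lt s_lt)
  have attains : AttainsRBBound (signMatrix N m rows) :=
    ⟨q, fun _ => ⟨rbIndex.unique, fun h => h ▸ rbIndex⟩, es2_eq.trans rbBound_eq.symm⟩
  have es2Optimal := attains.isEs2Optimal isSSD
  exact ⟨isSSD, sMax_eq, freqSMax_eq, es2_eq, attains, es2Optimal, es2Optimal.isMinimaxOptimal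
    fun _ => isSSD.isBalanced.sMax_le_natAbs_gram_add_four (sMax_eq.trans_le s_le)⟩

theorem isOptimalDesign_16_25 : IsOptimalDesign design_16_25 4 144 (192 / 25) :=
  isOptimalDesign_signMatrix (q := 1) (by decide) (by decide +kernel) (by decide +kernel)
    (by decide +kernel)

theorem isOptimalDesign_16_26 : IsOptimalDesign design_16_26 4 160 (512 / 65) :=
  isOptimalDesign_signMatrix (q := 0) (by decide) (by decide +kernel) (by decide +kernel)
    (by decide +kernel)

theorem isOptimalDesign_16_27 : IsOptimalDesign design_16_27 4 184 (2944 / 351) :=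
  isOptimalDesign_signMatrix (q := 3) (by decide) (by decide +kernel) (by decide +kernel)
    (by decide +kernel)

theorem isOptimalDesign_18_23 : IsOptimalDesign design_18_23 6 17 (1556 / 253) :=
  isOptimalDesign_signMatrix (q := 3) (by decide) (by decide +kernel) (by decide +kernel)
    (by decide +kernel)

theorem isOptimalDesign_18_24 : IsOptimalDesign design_18_24 6 23 (20 / 3) :=
  isOptimalDesign_signMatrix (q := 2) (by decide) (by decide +kernel) (by decide +kernel)
    (by decide +kernel)

theorem isOptimalDesign_18_25 : IsOptimalDesign design_18_25 6 30 (36 / 5) :=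
  isOptimalDesign_signMatrix (q := 1) (by decide) (by decide +kernel) (by decide +kernel)
    (by decide +kernel)

theorem isOptimalDesign_18_26 : IsOptimalDesign design_18_26 6 37 (2484 / 325) :=
  isOptimalDesign_signMatrix (q := 0) (by decide) (by decide +kernel) (by decide +kernel)
    (by decide +kernel)

theorem isOptimalDesign_18_27 : IsOptimalDesign design_18_27 6 45 (316 / 39) :=
  isOptimalDesign_signMatrix (q := 3) (by decide) (by decide +kernel) (by decide +kernel)
    (by decide +kernel)

theorem isOptimalDesign_18_28 : IsOptimalDesign design_18_28 6 53 (1604 / 189) :=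
  isOptimalDesign_signMatrix (q := 2) (by decide) (by decide +kernel) (by decide +kernel)
    (by decide +kernel)

theorem isOptimalDesign_18_29 : IsOptimalDesign design_18_29 6 60 (1772 / 203) :=
  isOptimalDesign_signMatrix (q := 1) (by decide) (by decide +kernel) (by decide +kernel)
    (by decide +kernel)

theorem isOptimalDesign_20_21 : IsOptimalDesign design_20_21 4 50 (80 / 21) :=
  isOptimalDesign_signMatrix (q := 1) (by decide) (by decide +kernel) (by decide +kernel)
    (by decide +kernel)

theorem isOptimalDesign_22_22 : IsOptimalDesign design_22_22 2 231 4 :=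
  isOptimalDesign_signMatrix (q := 0) (by decide) (by decide +kernel) (by decide +kernel)
    (by decide +kernel)

theorem isOptimalDesign_22_23 : IsOptimalDesign design_22_23 2 253 4 :=
  isOptimalDesign_signMatrix (q := 3) (by decide) (by decide +kernel) (by decide +kernel)
    (by decide +kernel)

theorem isOptimalDesign_24_24 : IsOptimalDesign design_24_24 4 36 (48 / 23) :=
  isOptimalDesign_signMatrix (q := 2) (by decide) (by decide +kernel) (by decide +kernel)
    (by decide +kernel)

theorem isOptimalDesign_24_25 : IsOptimalDesign design_24_25 4 72 (96 / 25) :=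
  isOptimalDesign_signMatrix (q := 1) (by decide) (by decide +kernel) (by decide +kernel)
    (by decide +kernel)

end Designs

theorem mainTheorem3 :
    IsOptimalDesign design_16_25 4 144 (192 / 25) ∧
    IsOptimalDesign design_16_26 4 160 (512 / 65) ∧
    IsOptimalDesign design_16_27 4 184 (2944 / 351) ∧
    IsOptimalDesign design_18_23 6 17 (1556 / 253) ∧
    IsOptimalDesign design_18_24 6 23 (20 / 3) ∧
    IsOptimalDesign design_18_25 6 30 (36 / 5) ∧
    IsOptimalDesign design_18_26 6 37 (2484 / 325) ∧
    IsOptimalDesign design_18_27 6 45 (316 / 39) ∧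
    IsOptimalDesign design_18_28 6 53 (1604 / 189) ∧
    IsOptimalDesign design_18_29 6 60 (1772 / 203) ∧
    IsOptimalDesign design_20_21 4 50 (80 / 21) ∧
    IsOptimalDesign design_22_22 2 231 4 ∧
    IsOptimalDesign design_22_23 2 253 4 ∧
    IsOptimalDesign design_24_24 4 36 (48 / 23) ∧
    IsOptimalDesign design_24_25 4 72 (96 / 25) := by
  exact ⟨isOptimalDesign_16_25, isOptimalDesign_16_26, isOptimalDesign_16_27, isOptimalDesign_18_23,
    isOptimalDesign_18_24, isOptimalDesign_18_25, isOptimalDesign_18_26, isOptimalDesign_18_27,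
    isOptimalDesign_18_28, isOptimalDesign_18_29, isOptimalDesign_20_21, isOptimalDesign_22_22,
    isOptimalDesign_22_23, isOptimalDesign_24_24, isOptimalDesign_24_25⟩
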